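/- **Setting.** Let $A$ be a unital $\mathbb C$-algebra with a linear functional $\varphi\colon A\to\mathbb C$, $\varphi(1_A)=1$, and let $F$ be a (not necessarily unital) $\mathbb C$-algebra that is also a unital $A$-bimodule, with actions compatible with the multiplication of $F$ (that is, $(af)g=a(fg)$, $(fa)g=f(ag)$, $(fg)a=f(ga)$) and with complex scalars; let $\Phi\colon F\to\mathbb C$ be linear. No traciality is assumed. Let $B=A\oplus F$ be the unital algebra with product $(a_1,f_1)(a_2,f_2)=(a_1a_2,\;a_1f_2+f_1a_2+f_1f_2)$, regard $A$ and $F$ as subalgebras of $B$, and put $\varphi(a+f)=\varphi(a)$ and $\varphi'(a+f)=\Phi(f)$ for $a\in A$, $f\in F$. A pair $(A_1,F_1)$ of subalgebras $1_A\in A_1\subseteq A$, $F_1\subseteq F$ is *cyclic-antimonotone independent* if for all $n\ge1$, $a_0,\dots,a_n\in A_1$, $f_1,\dots,f_n\in F_1$, $$\Phi(a_0f_1a_1f_2\cdots a_{n-1}f_na_n)=\varphi(a_0a_n)\Big[\prod_{1\le i\le n-1}\varphi(a_i)\Big]\Phi(f_1f_2\cdots f_n).$$ For $q\in F$, $(A,\{q\})$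 is called cyclic-antimonotone independent if $(A,F_1)$ is, where $F_1$ is the subalgebra of $F$ generated by $q$. Let $NC(n)$ be the set of noncrossing partitions of $\{1,\dots,n\}$ ordered by refinement, with Möbius function $\mu_n$; for $\pi\in NC(n)$ let $$\varphi_\pi[b_1,\dots,b_n]=\prod_{\{i_1<\dots<i_k\}\in\pi}\varphi(b_{i_1}\cdots b_{i_k}),\qquad \kappa_\pi=\sum_{\sigma\in NC(n),\,\sigma\le\pi}\varphi_\sigma\,\mu_n(\sigma,\pi)$$ (the free cumulants). The Kreweras complement $\mathrm{Kr}(\pi)$ is the largest $\sigma\in NC(n)$ such that the union of $\pi$ on $\{1,\dots,n\}$ and the copy of $\sigma$ on $\{\bar1,\dots,\bar n\}$ is a noncrossing partition of the ordered set $1<\bar1<2<\bar2<\dots<n<\bar n$; $|\mathrm{Kr}(\pi)|$ is its number of blocks. **Theorem.** Let $q\in F$ satisfy $q^2=q$ and $\Phi(q)=1$, and suppose that $(A,\{q\})$ is cyclic-antimonotone independent. Put $p=1_B-q\in B$ and $\tilde a=pap\in B$ for $a\in A$. Then for every $n\ge1$ and all $a_1,\dots,a_n\in A$, $$\varphi'(\tilde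 a_1\tilde a_2\cdots\tilde a_n)=-\sum_{\pi\in NC(n)}|\mathrm{Kr}(\pi)|\,\kappa_\pi[a_1,a_2,\dots,a_n].$$ (The functional $M_n[a_1,\dots,a_n]:=-\varphi'(\tilde a_1\cdots\tilde a_n)$ is called the multivariate inverse Markov–Krein transform.) -/

import Mathlib

open Finset
open scoped RightActions

namespace TypeBPrime

/-! ### Noncrossing partitions and the Kreweras complement -/

section Noncrossing

/-- A family of blocks in a linearly ordered set is noncrossing if there are no
`i < j < k < l` with `i, k` in one block and `j, l` in a different block. -/
def IsNoncrossing {L : Type*} [LinearOrder L] (P : Finset (Finset L)) : Prop :=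
  ∀ V ∈ P, ∀ W ∈ P, ∀ i ∈ V, ∀ j ∈ W, ∀ k ∈ V, ∀ l ∈ W, i < j → j < k → k < l → V = W

/-- `NC n`: the noncrossing partitions of `Fin n`, ordered by refinement
(`π ≤ σ` iff every block of `π` is contained in a block of `σ`). -/
abbrev NC (n : ℕ) : Type :=
  {π : Finpartition (univ : Finset (Fin n)) // IsNoncrossing π.parts}

/-- The set of blocks of `π ∪ σ`, where `π` is regarded as a partition of the unbarred copies and
`σ` as a partition of the barred copies in the ordered set
`0 < 0bar < 1 < 1bar < ⋯ < n - 1 < (n - 1)bar`; here `i` is `(i, false)` and `ibar` is `(i, true)`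
in the lexicographic product. -/
def interleave {n : ℕ} (π σ : NC n) : Finset (Finset (Fin n ×ₗ Bool)) :=
  π.1.parts.image (fun V => V.image fun i => toLex (i, false)) ∪
    σ.1.parts.image (fun V => V.image fun i => toLex (i, true))

variable {n : ℕ}

/-- Two points are related if they are not separated by any pair of points of a common block. -/
def krSetoid (π : NC n) : Setoid (Fin n) :=
  Setoid.ker fun i : Fin n => fun V : Finset (Fin n) => fun a : Fin n => fun b : Fin n =>
    V ∈ π.1.parts → a ∈ V → b ∈ V → (a ≤ i ↔ b ≤ i)

theorem krSetoid_iff (π : NC n) (i j : Fin n) : krSetoid π i j ↔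
    ∀ V ∈ π.1.parts, ∀ a ∈ V, ∀ b ∈ V, ((a ≤ i ↔ b ≤ i) ↔ (a ≤ j ↔ b ≤ j)) := by
  rw [krSetoid, Setoid.ker_def]
  constructor
  · intro h V hV a ha b hb
    have := congrFun (congrFun (congrFun h V) a) b
    simpa [hV, ha, hb] using this
  · intro h
    funext V a b
    by_cases hV : V ∈ π.1.parts
    · by_cases ha : a ∈ V
      · by_cases hb : b ∈ V
        · simpa [hV, ha, hb] using h V hV a ha b hb
        · simp [hb]
      · simp [ha]
    · simp [hV]

theorem toLex_lt_iff (i j : Fin n) (s t : Bool) :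
    (toLex (i, s) : Fin n ×ₗ Bool) < toLex (j, t) ↔ i < j ∨ (i = j ∧ s < t) := by
  simp [Prod.Lex.toLex_lt_toLex]

theorem mem_ofSetoid_rel (s : Setoid (Fin n)) [DecidableRel s.r] {V : Finset (Fin n)}
    (hV : V ∈ (Finpartition.ofSetoid s).parts) {i j : Fin n} (hi : i ∈ V) : j ∈ V ↔ s i j := by
  rw [← Finpartition.mem_part_ofSetoid_iff_rel, Finpartition.part_eq_of_mem _ hV hi]

/-- Among the noncrossing partitions `σ` such that `π ∪ σ` is noncrossing on the interleaved set,
there is a largest one. -/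
theorem exists_isGreatest_kreweras (π : NC n) :
    ∃ κ : NC n, IsGreatest {σ : NC n | IsNoncrossing (interleave π σ)} κ := by
  classical
  let K := Finpartition.ofSetoid (krSetoid π)
  have hrel : ∀ W ∈ K.parts, ∀ i ∈ W, ∀ j ∈ W, ∀ V ∈ π.1.parts, ∀ a ∈ V, ∀ b ∈ V,
      ((a ≤ i ↔ b ≤ i) ↔ (a ≤ j ↔ b ≤ j)) := fun W hW i hi j hj =>
    (krSetoid_iff π i j).1 ((mem_ofSetoid_rel _ hW hi).1 hj)
  have hK : IsNoncrossing K.parts := by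
    intro V hV W hW i hi j hj k hk l hl hij hjk hkl
    refine K.eq_of_mem_parts hV hW ((mem_ofSetoid_rel _ hV hi).2 ?_) hj
    refine (krSetoid_iff π i j).2 fun U hU a ha b hb => ?_
    have h1 := hrel V hV i hi k hk U hU a ha b hb
    have h2 := hrel W hW j hj l hl U hU a ha b hb
    grind
  refine ⟨⟨K, hK⟩, ?_, ?_⟩
  · intro V hV W hW i hi j hj k hk l hl hij hjk hkl
    simp only [interleave, mem_union, mem_image] at hV hW
    rcases hV with ⟨V, hV, rfl⟩ | ⟨V, hV, rfl⟩ <;> rcases hW with ⟨W, hW, rfl⟩ | ⟨W, hW, rfl⟩ <;>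
      simp only [mem_image] at hi hj hk hl <;>
      obtain ⟨i, hi, rfl⟩ := hi <;> obtain ⟨j, hj, rfl⟩ := hj <;>
      obtain ⟨k, hk, rfl⟩ := hk <;> obtain ⟨l, hl, rfl⟩ := hl <;>
      rw [toLex_lt_iff] at hij hjk hkl
    · simp only [lt_self_iff_false, and_false, or_false] at hij hjk hkl
      rw [π.2 V hV W hW i hi j hj k hk l hl hij hjk hkl]
    · have h := hrel W hW j hj l hl V hV i hi k hk
      have hij' : i ≤ j := hij.elim le_of_lt fun h => h.1.le
      have hjk' : j < k := hjk.resolve_right fun h => absurd h.2 (by decide)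
      have hkl' : k ≤ l := hkl.elim le_of_lt fun h => h.1.le
      exact absurd (h.2 (iff_of_true (hij'.trans (hjk'.le.trans hkl')) hkl')) (by simp [hij', hjk'])
    · have h := hrel V hV i hi k hk W hW j hj l hl
      have hij' : i < j := hij.resolve_right fun h => absurd h.2 (by decide)
      have hjk' : j ≤ k := hjk.elim le_of_lt fun h => h.1.le
      have hkl' : k < l := hkl.resolve_right fun h => absurd h.2 (by decide)
      exact absurd (h.1 (iff_of_false hij'.not_ge (hij'.trans_le (hjk'.trans hkl'.le)).not_ge))
        (by simp [hjk', hkl'])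
    · simp only [lt_self_iff_false, and_false, or_false] at hij hjk hkl
      rw [hK V hV W hW i hi j hj k hk l hl hij hjk hkl]
  · intro σ hσ W hW
    have hσ' : IsNoncrossing (interleave π σ) := hσ
    obtain ⟨i, hi⟩ := σ.1.nonempty_of_mem_parts hW
    refine ⟨K.part i, K.part_mem.2 (mem_univ i), fun j hj => ?_⟩
    refine (Finpartition.mem_part_ofSetoid_iff_rel).2 ?_
    refine (krSetoid_iff π i j).2 ?_
    -- a block of `σ` is not separated by two points of a block of `π`
    have key : ∀ V ∈ π.1.parts, ∀ a ∈ V, ∀ b ∈ V, ∀ x ∈ W, ∀ y ∈ W,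
        a ≤ x → x < b → a ≤ y ∧ y < b := by
      intro V hV a ha b hb x hx y hy hax hxb
      by_contra hcon
      have hV' : V.image (fun i => (toLex (i, false) : Fin n ×ₗ Bool)) ∈ interleave π σ :=
        mem_union_left _ (mem_image_of_mem _ hV)
      have hW' : W.image (fun i => (toLex (i, true) : Fin n ×ₗ Bool)) ∈ interleave π σ :=
        mem_union_right _ (mem_image_of_mem _ hW)
      have hne : V.image (fun i => (toLex (i, false) : Fin n ×ₗ Bool)) ≠
          W.image (fun i => (toLex (i, true) : Fin n ×ₗ Bool)) := by
        intro h
        have h1 : (toLex (a, false) : Fin n ×ₗ Bool) ∈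
            V.image (fun i => (toLex (i, false) : Fin n ×ₗ Bool)) := mem_image_of_mem _ ha
        rw [h] at h1
        simp at h1
      rcases lt_or_ge y a with hya | hay
      · refine hne (hσ' _ hW' _ hV' _ (mem_image_of_mem _ hy) _ (mem_image_of_mem _ ha)
          _ (mem_image_of_mem _ hx) _ (mem_image_of_mem _ hb) ?_ ?_ ?_).symm <;>
          rw [toLex_lt_iff]
        · exact Or.inl hya
        · rcases hax.lt_or_eq with h | h
          · exact Or.inl h
          · exact Or.inr ⟨h, by decide⟩
        · exact Or.inl hxb
      · have hby : b ≤ y := by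
          by_contra h
          exact hcon ⟨hay, not_le.1 h⟩
        refine hne (hσ' _ hV' _ hW' _ (mem_image_of_mem _ ha) _ (mem_image_of_mem _ hx)
          _ (mem_image_of_mem _ hb) _ (mem_image_of_mem _ hy) ?_ ?_ ?_) <;>
          rw [toLex_lt_iff]
        · rcases hax.lt_or_eq with h | h
          · exact Or.inl h
          · exact Or.inr ⟨h, by decide⟩
        · exact Or.inl hxb
        · rcases hby.lt_or_eq with h | h
          · exact Or.inl h
          · exact Or.inr ⟨h, by decide⟩
    intro V hV a ha b hb
    have k1 := key V hV a ha b hb i hi j hj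
    have k2 := key V hV b hb a ha i hi j hj
    have k3 := key V hV a ha b hb j hj i hi
    have k4 := key V hV b hb a ha j hj i hi
    grind

/-- The Kreweras complement `Kr(π)`: the largest noncrossing partition `σ` of the barred points
such that `π ∪ σ` is noncrossing. -/
noncomputable def kreweras (π : NC n) : NC n := (exists_isGreatest_kreweras π).choose

theorem isGreatest_kreweras (π : NC n) :
    IsGreatest {σ : NC n | IsNoncrossing (interleave π σ)} (kreweras π) :=
  (exists_isGreatest_kreweras π).choose_spec

open scoped Classical in
noncomputable instance : Fintype (NC n) := Subtype.fintype _

open scoped Classical in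
noncomputable instance : LocallyFiniteOrder (NC n) := Fintype.toLocallyFiniteOrder

end Noncrossing

/-! ### Free cumulants -/

section Cumulants

variable {B : Type*} [Ring B] [Algebra ℂ B] {n : ℕ}

/-- `φ_π[b₁, …, bₙ] = ∏_{V ∈ π} φ(b_{i₁} ⋯ b_{i_k})`, where `V = {i₁ < ⋯ < i_k}`. -/
noncomputable def moment (φ : B →ₗ[ℂ] ℂ) (π : NC n) (b : Fin n → B) : ℂ :=
  ∏ V ∈ π.1.parts, φ ((V.sort (· ≤ ·)).map b).prod

open scoped Classical in
/-- The free cumulant `κ_π = ∑_{σ ≤ π} φ_σ μ(σ, π)` with respect to `φ`, where `μ` is the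
Möbius function of the poset `NC n`. -/
noncomputable def freeCumulant (φ : B →ₗ[ℂ] ℂ) (π : NC n) (b : Fin n → B) : ℂ :=
  ∑ σ : NC n with σ ≤ π, moment φ σ b * IncidenceAlgebra.mu ℂ σ π

end Cumulants

/-! ### Noncommutative probability spaces of type B′ -/

/-- `F` is an `A`-algebra: an algebra with an `A`-bimodule structure (left action `a • f`, right
action `f <• a`) which is compatible with the multiplication of `F` and with complex scalars. -/
class BimoduleAlgebra (A F : Type*) [Ring A] [Algebra ℂ A] [NonUnitalRing F] [Module ℂ F]
    [Module A F] [Module Aᵐᵒᵖ F] : Prop where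
  /-- `(a f) b = a (f b)` -/
  smul_right : ∀ (a : A) (f : F) (b : A), (a • f) <• b = a • (f <• b)
  /-- `(a f) g = a (f g)` -/
  left_mul : ∀ (a : A) (f g : F), (a • f) * g = a • (f * g)
  /-- `(f a) g = f (a g)` -/
  mid_mul : ∀ (f : F) (a : A) (g : F), (f <• a) * g = f * (a • g)
  /-- `(f g) a = f (g a)` -/
  right_mul : ∀ (f g : F) (a : A), (f * g) <• a = f * (g <• a)
  /-- `(c a) f = c (a f)` -/
  scalar_left : ∀ (c : ℂ) (a : A) (f : F), (c • a) • f = c • (a • f)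
  /-- `f (c a) = c (f a)` -/
  scalar_right : ∀ (c : ℂ) (f : F) (a : A), f <• (c • a) = c • (f <• a)

/-- The underlying set of the algebra `A⟨F⟩ = A ⊕ F`; the element `a + f` has main term `a` and
perturbation term `f`. -/
@[ext]
structure Link (A F : Type*) where
  /-- the main term -/
  main : A
  /-- the perturbation term -/
  pert : F

namespace Link

section Additive

variable {A F : Type*} [Ring A] [NonUnitalRing F]

/-- As a vector space, `A⟨F⟩` is `A ⊕ F`. -/
def equivProd (A F : Type*) : Link A F ≃ A × F where
  toFun b := (b.main, b.pert)
  invFun b := ⟨b.1, b.2⟩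
  left_inv _ := rfl
  right_inv _ := rfl

instance : AddCommGroup (Link A F) := (equivProd A F).addCommGroup

instance : One (Link A F) := ⟨⟨1, 0⟩⟩

@[simp] theorem main_zero : (0 : Link A F).main = 0 := rfl
@[simp] theorem pert_zero : (0 : Link A F).pert = 0 := rfl
@[simp] theorem main_one : (1 : Link A F).main = 1 := rfl
@[simp] theorem pert_one : (1 : Link A F).pert = 0 := rfl
@[simp] theorem main_add (x y : Link A F) : (x + y).main = x.main + y.main := rfl
@[simp] theorem pert_add (x y : Link A F) : (x + y).pert = x.pert + y.pert := rfl
@[simp] theorem main_neg (x : Link A F) : (-x).main = -x.main := rfl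
@[simp] theorem pert_neg (x : Link A F) : (-x).pert = -x.pert := rfl
@[simp] theorem main_sub (x y : Link A F) : (x - y).main = x.main - y.main := rfl
@[simp] theorem pert_sub (x y : Link A F) : (x - y).pert = x.pert - y.pert := rfl
/-- The embedding of `A` into `A⟨F⟩`. -/
def inl (a : A) : Link A F := ⟨a, 0⟩

/-- The embedding of `F` into `A⟨F⟩`. -/
def inr (f : F) : Link A F := ⟨0, f⟩

end Additive

section Multiplicative

variable {A F : Type*} [Ring A] [NonUnitalRing F] [Module A F] [Module Aᵐᵒᵖ F]

/-- `(a₁, f₁) (a₂, f₂) = (a₁ a₂, a₁ f₂ + f₁ a₂ + f₁ f₂)` -/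
instance : Mul (Link A F) :=
  ⟨fun x y => ⟨x.main * y.main, x.main • y.pert + x.pert <• y.main + x.pert * y.pert⟩⟩

@[simp] theorem main_mul (x y : Link A F) : (x * y).main = x.main * y.main := rfl
@[simp] theorem pert_mul (x y : Link A F) :
    (x * y).pert = x.main • y.pert + x.pert <• y.main + x.pert * y.pert := rfl

end Multiplicative

section Functionals

variable {A F : Type*} [Ring A] [Algebra ℂ A] [NonUnitalRing F] [Module ℂ F]

instance : Module ℂ (Link A F) := (equivProd A F).module ℂ

@[simp] theorem main_smul (c : ℂ) (x : Link A F) : (c • x).main = c • x.main := rfl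
@[simp] theorem pert_smul (c : ℂ) (x : Link A F) : (c • x).pert = c • x.pert := rfl
/-- `φ(a + f) = φ(a)` -/
def phi (φ : A →ₗ[ℂ] ℂ) : Link A F →ₗ[ℂ] ℂ where
  toFun b := φ b.main
  map_add' _ _ := by simp
  map_smul' _ _ := by simp

/-- `φ'(a + f) = Φ(f)` -/
def phi' (Φ : F →ₗ[ℂ] ℂ) : Link A F →ₗ[ℂ] ℂ where
  toFun b := Φ b.pert
  map_add' _ _ := by simp
  map_smul' _ _ := by simp

end Functionals

section Algebra

variable {A F : Type*} [Ring A] [Algebra ℂ A] [NonUnitalRing F] [Module ℂ F]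
  [Module A F] [Module Aᵐᵒᵖ F]

instance [BimoduleAlgebra A F] : Ring (Link A F) where
  __ := (inferInstance : AddCommGroup (Link A F))
  left_distrib x y z := by
    ext
    · simp [mul_add]
    · simp only [pert_mul, main_add, pert_add, smul_add, mul_add, MulOpposite.op_add, add_smul]
      abel
  right_distrib x y z := by
    ext
    · simp [add_mul]
    · simp only [pert_mul, main_add, pert_add, smul_add, add_mul, add_smul]
      abel
  zero_mul x := by ext <;> simp
  mul_zero x := by ext <;> simp
  one_mul x := by ext <;> simp
  mul_one x := by ext <;> simp
  mul_assoc x y z := by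
    ext
    · simp [mul_assoc]
    · simp only [pert_mul, main_mul, smul_add, add_mul, mul_add, mul_smul, MulOpposite.op_mul,
        BimoduleAlgebra.smul_right, BimoduleAlgebra.left_mul, BimoduleAlgebra.mid_mul,
        BimoduleAlgebra.right_mul, mul_assoc]
      abel

instance [IsScalarTower ℂ F F] [SMulCommClass ℂ F F] [BimoduleAlgebra A F] :
    Algebra ℂ (Link A F) :=
  Algebra.ofModule
    (fun c x y => by
      ext
      · simp
      · have h : (c • x.pert) <• y.main = c • (x.pert <• y.main) := by
          have h1 : c • x.pert = x.pert <• (c • (1 : A)) := by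
            rw [BimoduleAlgebra.scalar_right, MulOpposite.op_one, one_smul]
          rw [h1, ← BimoduleAlgebra.scalar_right, smul_smul, ← MulOpposite.op_mul, smul_mul_assoc,
            one_mul]
        simp [BimoduleAlgebra.scalar_left, h, smul_mul_assoc])
    (fun c x y => by
      ext
      · simp
      · have h : x.main • (c • y.pert) = c • (x.main • y.pert) := by
          have h1 : c • y.pert = (c • (1 : A)) • y.pert := by
            rw [BimoduleAlgebra.scalar_left, one_smul]
          rw [h1, ← BimoduleAlgebra.scalar_left, smul_smul, mul_smul_comm, mul_one]
        simp only [pert_mul, main_smul, pert_smul, BimoduleAlgebra.scalar_right, h, mul_smul_comm,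
          smul_add])

end Algebra

end Link

/-! ### Cyclic-antimonotone independence -/

section Independence

variable {A F : Type*} [Ring A] [Algebra ℂ A] [NonUnitalRing F] [Module ℂ F]
  [Module A F] [Module Aᵐᵒᵖ F]

/-- The product `f₀ f₁ ⋯ fₙ` of `n + 1` elements of `F`. -/
def prodF (f : ℕ → F) : ℕ → F
  | 0 => f 0
  | n + 1 => prodF f n * f (n + 1)

/-- The product `a₀ f₀ a₁ f₁ a₂ ⋯ fₙ aₙ₊₁` in `F`, with `n + 1` factors from `F`. -/
def altProd (a : ℕ → A) (f : ℕ → F) : ℕ → F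
  | 0 => a 0 • (f 0 <• a 1)
  | n + 1 => altProd a f n * (f (n + 1) <• a (n + 2))

/-- The pair `(A₁, F₁)` of subalgebras is cyclic-antimonotone independent:
`Φ(a₀ f₀ a₁ ⋯ fₙ aₙ₊₁) = φ(a₀ aₙ₊₁) φ(a₁) ⋯ φ(aₙ) Φ(f₀ ⋯ fₙ)` for all `n ≥ 0`. -/
def CyclicAntimonotone (φ : A →ₗ[ℂ] ℂ) (Φ : F →ₗ[ℂ] ℂ) (A₁ : Subalgebra ℂ A)
    (F₁ : NonUnitalSubalgebra ℂ F) : Prop :=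
  ∀ (n : ℕ) (a : ℕ → A) (f : ℕ → F), (∀ i ≤ n + 1, a i ∈ A₁) → (∀ i ≤ n, f i ∈ F₁) →
    Φ (altProd a f n) = φ (a 0 * a (n + 1)) * (∏ i ∈ Finset.Icc 1 n, φ (a i)) * Φ (prodF f n)

end Independence

end TypeBPrime

/-!
Write `p = 1 - q`. The proof compares both sides with a sum over sets of cuts on a circle.
A nonempty set `C` of barred points cuts the circle `0 < 0bar < 1 < ⋯ < (n - 1)bar` into cyclic
intervals, which are the blocks of a noncrossing partition `π_C` (`cyclicInterval`), and both sides
turn out to be `∑_C (-1)^|C| φ_{π_C}[a]`.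

On the algebraic side, cyclic-antimonotone independence and `Φ(q) = 1` evaluate `φ'` on every word
in `q` and elements of `A` (`CyclicAntimonotone.factorsOnWords`). The evaluation does not see
whether the word begins with `q`, ends with `q`, or both, which gives `φ'(q a₁ p ⋯ aₙ p) = 0`, and
so the product of the `p aᵢ p` may be replaced by `a₁ p a₂ p ⋯ aₙ p`. Expanding each
`aᵢ p = aᵢ - aᵢ q` yields a sum over the sets `C` of places where `q` is chosen, and the word
attached to a nonempty `C` has value `φ_{π_C}[a]` (`FactorsOnWords.phi'_prod_cut`): the pieces
before the first and after the last `q` are multiplied together, which is the cyclic closing up.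

On the combinatorial side, `π ≤ π_C` says that no block of `π` is separated by `C`, that is, that
`C` lies in a single block of `Kr(π)`. As `∑_{∅ ≠ C ⊆ W} (-1)^(|C| + 1) = 1` for every block `W`,
the number of blocks is `|Kr(π)| = ∑_{C ≠ ∅, π ≤ π_C} (-1)^(|C| + 1)` (`card_parts_kreweras`).
Exchanging the sums and using `φ_ρ = ∑_{π ≤ ρ} κ_π` gives the same sum over `C`, up to the sign.
-/

namespace TypeBPrime

/-! ### Cyclic interval partitions and the Kreweras complement -/

section Combinatorics

variable {n : ℕ}

/-- Two points are related if either no cut or every cut lies between them, where a cut at `ibar`,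
for `i ∈ C`, separates the points `≤ i` from the points `> i`. Points with every cut between them
are joined through the place where the circle closes up. This is the relation `krSetoid` with the
two kinds of points exchanged. -/
def cutSetoid (C : Finset (Fin n)) : Setoid (Fin n) where
  r a b := ∀ i ∈ C, ∀ j ∈ C, ((a ≤ i ↔ b ≤ i) ↔ (a ≤ j ↔ b ≤ j))
  iseqv :=
    { refl := fun _ _ _ _ _ => by simp
      symm := fun h i hi j hj => by have := h i hi j hj; tauto
      trans := fun h₁ h₂ i hi j hj => by have := h₁ i hi j hj; have := h₂ i hi j hj; tauto }

theorem cutSetoid_iff (C : Finset (Fin n)) (a b : Fin n) : cutSetoid C a b ↔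
    ∀ i ∈ C, ∀ j ∈ C, ((a ≤ i ↔ b ≤ i) ↔ (a ≤ j ↔ b ≤ j)) := Iff.rfl

open scoped Classical in
theorem isNoncrossing_ofSetoid_cutSetoid (C : Finset (Fin n)) :
    IsNoncrossing (Finpartition.ofSetoid (cutSetoid C)).parts := by
  intro V hV W hW i hi j hj k hk l hl hij hjk hkl
  refine Finpartition.eq_of_mem_parts _ hV hW ((mem_ofSetoid_rel _ hV hi).2 ?_) hj
  have h1 := (mem_ofSetoid_rel _ hV hi).1 hk
  have h2 := (mem_ofSetoid_rel _ hW hj).1 hl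
  rw [cutSetoid_iff] at *
  intro s hs t ht
  have h3 := h1 s hs t ht
  have h4 := h2 s hs t ht
  grind

open scoped Classical in
/-- The partition into the cyclic intervals that arise by cutting the circle after each point of
`C`. It has `|C|` blocks when `C` is nonempty, and one block (for `n ≥ 1`) when `C` is empty. -/
noncomputable def cyclicInterval (C : Finset (Fin n)) : NC n :=
  ⟨Finpartition.ofSetoid (cutSetoid C), isNoncrossing_ofSetoid_cutSetoid C⟩

/-- A partition refines the one cut out by `C` exactly when none of its blocks separates two points
of `C`: the defining conditions of `cutSetoid` and `krSetoid` are the same up to the order of the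
quantifiers. -/
theorem le_cyclicInterval_iff (π : NC n) (C : Finset (Fin n)) :
    π ≤ cyclicInterval C ↔ ∀ i ∈ C, ∀ j ∈ C, krSetoid π i j := by
  classical
  constructor
  · intro h i hi j hj
    rw [krSetoid_iff]
    intro V hV a ha b hb
    obtain ⟨W, hW, hVW⟩ := h hV
    exact (mem_ofSetoid_rel _ hW (hVW ha)).1 (hVW hb) i hi j hj
  · intro h V hV
    obtain ⟨a, ha⟩ := π.1.nonempty_of_mem_parts hV
    refine ⟨_, (Finpartition.part_mem _).2 (mem_univ a), fun b hb => ?_⟩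
    refine Finpartition.mem_part_ofSetoid_iff_rel.2 ?_
    exact fun i hi j hj => (krSetoid_iff π i j).1 (h i hi j hj) V hV a ha b hb

theorem isNoncrossing_interleave_iff (π σ : NC n) :
    IsNoncrossing (interleave π σ) ↔ ∀ W ∈ σ.1.parts, ∀ i ∈ W, ∀ j ∈ W, krSetoid π i j := by
  have hft : false < true := by decide
  have htf : ¬ true < false := by decide
  constructor
  · intro hσ W hW i hi j hj
    rw [krSetoid_iff]
    -- a block of `σ` is not separated by two points of a block of `π`
    have key : ∀ V ∈ π.1.parts, ∀ a ∈ V, ∀ b ∈ V, ∀ x ∈ W, ∀ y ∈ W,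
        a ≤ x → x < b → a ≤ y ∧ y < b := by
      intro V hV a ha b hb x hx y hy hax hxb
      by_contra hcon
      have hV' : V.image (fun i => (toLex (i, false) : Fin n ×ₗ Bool)) ∈ interleave π σ :=
        mem_union_left _ (mem_image_of_mem _ hV)
      have hW' : W.image (fun i => (toLex (i, true) : Fin n ×ₗ Bool)) ∈ interleave π σ :=
        mem_union_right _ (mem_image_of_mem _ hW)
      have hne : V.image (fun i => (toLex (i, false) : Fin n ×ₗ Bool)) ≠
          W.image (fun i => (toLex (i, true) : Fin n ×ₗ Bool)) := by
        intro h
        have h1 := mem_image_of_mem (fun i => (toLex (i, false) : Fin n ×ₗ Bool)) ha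
        rw [h] at h1
        simp at h1
      rcases lt_or_ge y a with hya | hay
      · refine hne (hσ _ hW' _ hV' _ (mem_image_of_mem _ hy) _ (mem_image_of_mem _ ha)
          _ (mem_image_of_mem _ hx) _ (mem_image_of_mem _ hb) ?_ ?_ ?_).symm <;>
          simp only [toLex_lt_iff, hft, and_true] <;> grind
      · refine hne (hσ _ hV' _ hW' _ (mem_image_of_mem _ ha) _ (mem_image_of_mem _ hx)
          _ (mem_image_of_mem _ hb) _ (mem_image_of_mem _ hy) ?_ ?_ ?_) <;>
          simp only [toLex_lt_iff, hft, and_true] <;> grind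
    intro V hV a ha b hb
    have k1 := key V hV a ha b hb i hi j hj
    have k2 := key V hV b hb a ha i hi j hj
    have k3 := key V hV a ha b hb j hj i hi
    have k4 := key V hV b hb a ha j hj i hi
    grind
  · intro hrel V hV W hW i hi j hj k hk l hl hij hjk hkl
    simp only [interleave, mem_union, mem_image] at hV hW
    rcases hV with ⟨V, hV, rfl⟩ | ⟨V, hV, rfl⟩ <;> rcases hW with ⟨W, hW, rfl⟩ | ⟨W, hW, rfl⟩ <;>
      simp only [mem_image] at hi hj hk hl <;>
      obtain ⟨i, hi, rfl⟩ := hi <;> obtain ⟨j, hj, rfl⟩ := hj <;>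
      obtain ⟨k, hk, rfl⟩ := hk <;> obtain ⟨l, hl, rfl⟩ := hl <;>
      simp only [toLex_lt_iff, lt_self_iff_false, hft, htf, and_true, and_false, or_false]
        at hij hjk hkl
    · rw [π.2 V hV W hW i hi j hj k hk l hl hij hjk hkl]
    · have h := (krSetoid_iff π j l).1 (hrel W hW j hj l hl) V hV i hi k hk
      grind
    · have h := (krSetoid_iff π i k).1 (hrel V hV i hi k hk) W hW j hj l hl
      grind
    · rw [σ.2 V hV W hW i hi j hj k hk l hl hij hjk hkl]

open scoped Classical in
theorem isNoncrossing_ofSetoid_krSetoid (π : NC n) :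
    IsNoncrossing (Finpartition.ofSetoid (krSetoid π)).parts := by
  intro V hV W hW i hi j hj k hk l hl hij hjk hkl
  refine Finpartition.eq_of_mem_parts _ hV hW ((mem_ofSetoid_rel _ hV hi).2 ?_) hj
  have h1 := (krSetoid_iff _ _ _).1 ((mem_ofSetoid_rel _ hV hi).1 hk)
  have h2 := (krSetoid_iff _ _ _).1 ((mem_ofSetoid_rel _ hW hj).1 hl)
  refine (krSetoid_iff π i j).2 fun U hU a ha b hb => ?_
  have h3 := h1 U hU a ha b hb
  have h4 := h2 U hU a ha b hb
  grind

/-- Together with `mem_kreweras_of_krSetoid`, this identifies the blocks of `Kr(π)` with the classes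
of `krSetoid π`. -/
theorem krSetoid_of_mem_kreweras (π : NC n) {W : Finset (Fin n)} (hW : W ∈ (kreweras π).1.parts)
    {i j : Fin n} (hi : i ∈ W) (hj : j ∈ W) : krSetoid π i j :=
  (isNoncrossing_interleave_iff π _).1 (isGreatest_kreweras π).1 W hW i hi j hj

theorem mem_kreweras_of_krSetoid (π : NC n) {W : Finset (Fin n)} (hW : W ∈ (kreweras π).1.parts)
    {i j : Fin n} (hi : i ∈ W) (hij : krSetoid π i j) : j ∈ W := by
  classical
  have hle : (⟨_, isNoncrossing_ofSetoid_krSetoid π⟩ : NC n) ≤ kreweras π := by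
    refine (isGreatest_kreweras π).2 ((isNoncrossing_interleave_iff π _).2 ?_)
    exact fun W hW i hi j hj => (mem_ofSetoid_rel _ hW hi).1 hj
  obtain ⟨U, hU, hsub⟩ := hle ((Finpartition.part_mem _).2 (mem_univ i))
  have hiU : i ∈ U := hsub (Finpartition.mem_part_ofSetoid_iff_rel.2 ((krSetoid π).refl i))
  rw [(kreweras π).1.eq_of_mem_parts hW hU hi hiU]
  exact hsub (Finpartition.mem_part_ofSetoid_iff_rel.2 hij)

open scoped Classical in
/-- The sets `C` that occur are the nonempty subsets of the blocks of `Kr(π)`, and the signs over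
the nonempty subsets of one block add up to `1`. -/
theorem card_parts_kreweras (π : NC n) :
    ((kreweras π).1.parts.card : ℂ) =
      ∑ C : Finset (Fin n) with C.Nonempty ∧ π ≤ cyclicInterval C, (-1 : ℂ) ^ (C.card + 1) := by
  have hW : ∀ W ∈ (kreweras π).1.parts,
      ∑ C ∈ W.powerset with C.Nonempty, (-1 : ℂ) ^ (C.card + 1) = 1 := by
    intro W hW
    have h := Finset.sum_powerset_neg_one_pow_card_of_nonempty
      ((kreweras π).1.nonempty_of_mem_parts hW)
    have h' : ∑ C ∈ W.powerset, (-1 : ℂ) ^ C.card = 0 := by exact_mod_cast h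
    rw [← Finset.sum_filter_add_sum_filter_not _ (fun C : Finset (Fin n) => C.Nonempty)] at h'
    have h0 : W.powerset.filter (fun C => ¬ C.Nonempty) = {∅} := by
      ext C
      simp only [mem_filter, mem_powerset, not_nonempty_iff_eq_empty, mem_singleton]
      exact ⟨fun h => h.2, fun h => ⟨h ▸ empty_subset _, h⟩⟩
    rw [h0, sum_singleton, card_empty, pow_zero] at h'
    simp only [pow_succ, mul_neg, mul_one, sum_neg_distrib]
    linear_combination -h'
  have hunion : (univ.filter fun C : Finset (Fin n) => C.Nonempty ∧ π ≤ cyclicInterval C) =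
      (kreweras π).1.parts.biUnion fun W => W.powerset.filter fun C => C.Nonempty := by
    ext C
    simp only [mem_filter, mem_univ, true_and, mem_biUnion, mem_powerset, le_cyclicInterval_iff]
    constructor
    · rintro ⟨⟨i, hi⟩, h⟩
      have hp := (kreweras π).1.part_mem.2 (mem_univ i)
      exact ⟨_, hp, fun j hj => mem_kreweras_of_krSetoid π hp
        ((kreweras π).1.mem_part (mem_univ i)) (h i hi j hj), ⟨i, hi⟩⟩
    · rintro ⟨W, hW, hCW, hC⟩
      exact ⟨hC, fun i hi j hj => krSetoid_of_mem_kreweras π hW (hCW hi) (hCW hj)⟩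
  rw [hunion, sum_biUnion, sum_congr rfl hW, sum_const, nsmul_eq_mul, mul_one]
  intro U hU V hV hUV
  rw [Function.onFun, Finset.disjoint_left]
  simp only [mem_filter, mem_powerset]
  rintro C ⟨hCU, i, hi⟩ ⟨hCV, -⟩
  exact hUV ((kreweras π).1.eq_of_mem_parts hU hV (hCU hi) (hCV hi))

section

variable {B : Type*} [Ring B] [Algebra ℂ B]

open scoped Classical in
/-- The moment-cumulant formula, by Möbius inversion. -/
theorem moment_eq_sum_freeCumulant (φ : B →ₗ[ℂ] ℂ) (ρ : NC n) (b : Fin n → B) :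
    moment φ ρ b = ∑ π : NC n with π ≤ ρ, freeCumulant φ π b := by
  simp only [freeCumulant]
  rw [Finset.sum_comm' (t' := univ) (s' := fun σ => Finset.Icc σ ρ)
    (by intro x y; simp [and_comm])]
  simp_rw [← Finset.mul_sum, IncidenceAlgebra.sum_Icc_mu_right]
  simp

open scoped Classical in
theorem sum_card_kreweras_mul_freeCumulant (φ : B →ₗ[ℂ] ℂ) (b : Fin n → B) :
    ∑ π : NC n, ((kreweras π).1.parts.card : ℂ) * freeCumulant φ π b =
      ∑ C : Finset (Fin n) with C.Nonempty, (-1) ^ (C.card + 1) * moment φ (cyclicInterval C) b := by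
  simp_rw [card_parts_kreweras, moment_eq_sum_freeCumulant, Finset.sum_mul, Finset.mul_sum]
  exact Finset.sum_comm' (by intro x y; simp [and_comm])

end

/-! ### Blocks of a cyclic interval partition -/

/-- The block of the least cut wraps around: it also contains the points after the last cut. -/
theorem cutSetoid_min_iff {C : Finset (Fin n)} {c : Fin n} (hc : c ∈ C) (hmin : ∀ d ∈ C, c ≤ d)
    (x : Fin n) : cutSetoid C c x ↔ x ≤ c ∨ ∀ d ∈ C, d < x := by
  rw [cutSetoid_iff]
  constructor
  · intro h
    by_cases hx : x ≤ c
    · exact Or.inl hx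
    · refine Or.inr fun d hd => ?_
      have := h c hc d hd
      have := hmin d hd
      grind
  · rintro (h | h) i hi j hj
    · have := hmin i hi
      have := hmin j hj
      grind
    · have := hmin i hi
      have := hmin j hj
      have := h i hi
      have := h j hj
      grind

/-- The block of any other cut `c` reaches back from `c` to the preceding cut. -/
theorem cutSetoid_not_min_iff {C : Finset (Fin n)} {c e : Fin n} (hc : c ∈ C) (he : e ∈ C)
    (hec : e < c) (x : Fin n) : cutSetoid C c x ↔ x ≤ c ∧ ∀ d ∈ C, d < c → d < x := by
  rw [cutSetoid_iff]
  constructor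
  · intro h
    have h0 := h c hc e he
    have h1 : x ≤ c := by grind
    refine ⟨h1, fun d hd hdc => ?_⟩
    have := h c hc d hd
    grind
  · rintro ⟨h1, h2⟩ i hi j hj
    have := h2 i hi
    have := h2 j hj
    grind

theorem exists_cutSetoid {C : Finset (Fin n)} (hC : C.Nonempty) (x : Fin n) :
    ∃ c ∈ C, cutSetoid C c x := by
  classical
  by_cases hx : ∃ d ∈ C, x ≤ d
  · obtain ⟨c, hc, hcmin⟩ := Finset.exists_min_image (C.filter (x ≤ ·)) id
      (by obtain ⟨d, hd, h⟩ := hx; exact ⟨d, by simp [hd, h]⟩)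
    simp only [mem_filter, id] at hc hcmin
    refine ⟨c, hc.1, ?_⟩
    rw [cutSetoid_iff]
    intro i hi j hj
    have := hcmin i
    have := hcmin j
    grind
  · -- after the last cut, `x` lies in the block of the first one
    push Not at hx
    refine ⟨C.min' hC, C.min'_mem hC, ?_⟩
    rw [cutSetoid_min_iff (C.min'_mem hC) (fun d hd => C.min'_le d hd)]
    exact Or.inr hx

theorem eq_of_cutSetoid {C : Finset (Fin n)} {c d : Fin n} (hc : c ∈ C) (hd : d ∈ C)
    (h : cutSetoid C c d) : c = d := by
  have := (cutSetoid_iff C c d).1 h c hc d hd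
  grind

open scoped Classical in
/-- The blocks are in bijection with the cuts, each block containing exactly one point of `C`. -/
theorem prod_parts_cyclicInterval {C : Finset (Fin n)} (hC : C.Nonempty)
    (g : Finset (Fin n) → ℂ) :
    ∏ V ∈ (cyclicInterval C).1.parts, g V = ∏ c ∈ C, g {x | cutSetoid C c x} := by
  have hpart : ∀ c, (cyclicInterval C).1.part c = ({x | cutSetoid C c x} : Finset (Fin n)) := by
    intro c
    ext x
    simp only [mem_filter, mem_univ, true_and]
    exact Finpartition.mem_part_ofSetoid_iff_rel
  have himage : (cyclicInterval C).1.parts =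
      C.image fun c => ({x | cutSetoid C c x} : Finset (Fin n)) := by
    ext V
    simp only [mem_image, ← hpart]
    constructor
    · intro hV
      obtain ⟨x, hx⟩ := (cyclicInterval C).1.nonempty_of_mem_parts hV
      obtain ⟨c, hc, hcx⟩ := exists_cutSetoid hC x
      refine ⟨c, hc, (cyclicInterval C).1.part_eq_of_mem hV ?_⟩
      exact (mem_ofSetoid_rel _ hV hx).2 ((cutSetoid C).symm hcx)
    · rintro ⟨c, -, rfl⟩
      exact (cyclicInterval C).1.part_mem.2 (mem_univ c)
  rw [himage, prod_image]
  intro c hc d hd hcd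
  have : d ∈ ({x | cutSetoid C c x} : Finset (Fin n)) := by
    simp only at hcd
    rw [hcd]
    simp
  exact eq_of_cutSetoid hc hd (by simpa using this)

end Combinatorics

/-! ### Words with inserted cuts -/

section Words

/-- The increasing list of the numbers `x < N` that come after every element of `C` below `N`. -/
def tailSegment (C : Finset ℕ) : ℕ → List ℕ
  | 0 => []
  | N + 1 => if N ∈ C then [] else tailSegment C N ++ [N]

theorem mem_tailSegment (C : Finset ℕ) (N x : ℕ) :
    x ∈ tailSegment C N ↔ x < N ∧ ∀ d ∈ C, d < N → d < x := by
  induction N with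
  | zero => simp [tailSegment]
  | succ N ih =>
    rw [tailSegment]
    split_ifs with h
    · simp only [List.not_mem_nil, false_iff]
      rintro ⟨h1, h2⟩
      have := h2 N h (by omega)
      omega
    · rw [List.mem_append, ih, List.mem_singleton]
      grind

theorem pairwise_tailSegment (C : Finset ℕ) (N : ℕ) : (tailSegment C N).Pairwise (· < ·) := by
  induction N with
  | zero => simp [tailSegment]
  | succ N ih =>
    rw [tailSegment]
    split_ifs with h
    · simp
    · rw [List.pairwise_append]
      refine ⟨ih, by simp, fun x hx y hy => ?_⟩
      rw [List.mem_singleton.1 hy]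
      exact ((mem_tailSegment C N x).1 hx).1

/-- The word `b₀ b₁ ⋯ b_{N-1}` with `z` inserted after each factor whose index is in `C`, grouped
into the segments between consecutive insertions. -/
theorem prod_range_cut {B : Type*} [Monoid B] (C : Finset ℕ) (b : ℕ → B) (z : B) (N : ℕ) :
    ((List.range N).map fun i => if i ∈ C then b i * z else b i).prod =
      (((List.range N).filter (· ∈ C)).map
        fun c => ((tailSegment C c ++ [c]).map b).prod * z).prod *
        ((tailSegment C N).map b).prod := by
  induction N with
  | zero => simp [tailSegment]
  | succ N ih =>
    rw [List.range_succ, List.map_append, List.prod_append, ih, List.filter_append, tailSegment]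
    by_cases h : N ∈ C <;> simp [h, mul_assoc]

theorem sort_map_val_eq {n : ℕ} (V : Finset (Fin n)) (l : List ℕ) (hl : l.Pairwise (· < ·))
    (h : ∀ x, x ∈ l ↔ ∃ hx : x < n, (⟨x, hx⟩ : Fin n) ∈ V) :
    (V.sort (· ≤ ·)).map Fin.val = l := by
  have hs : ((V.sort (· ≤ ·)).map Fin.val).Pairwise (· < ·) :=
    List.pairwise_map.2 (V.sortedLT_sort.pairwise)
  refine List.Perm.eq_of_pairwise (le := (· < ·)) (fun a b _ _ h1 h2 => absurd h1 h2.asymm) hs hl ?_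
  refine (List.perm_ext_iff_of_nodup (hs.imp ne_of_lt) (hl.imp ne_of_lt)).2 fun x => ?_
  rw [h, List.mem_map]
  constructor
  · rintro ⟨y, hy, rfl⟩
    exact ⟨y.2, (Finset.mem_sort _).1 hy⟩
  · rintro ⟨hx, hV⟩
    exact ⟨⟨x, hx⟩, (Finset.mem_sort _).2 hV, rfl⟩

theorem prod_map_sort {α M : Type*} [LinearOrder α] [CommMonoid M] (s : Finset α) (g : α → M) :
    ((s.sort (· ≤ ·)).map g).prod = ∏ x ∈ s, g x := by
  change _ = (Multiset.map g s.val).prod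
  rw [← s.sort_eq (· ≤ ·), Multiset.map_coe, Multiset.prod_coe]

end Words

/-! ### Evaluation of words in `q` and `A` -/

section LinkAlgebra

open Link

section Embeddings

variable {A F : Type*} [Ring A] [NonUnitalRing F] [Module A F] [Module Aᵐᵒᵖ F]

theorem inl_mul_inl (a b : A) : (inl a * inl b : Link A F) = inl (a * b) := by
  ext <;> simp [inl]

theorem inr_mul_inr (f g : F) : (inr f * inr g : Link A F) = inr (f * g) := by
  ext <;> simp [inr]

theorem inl_mul_inr (a : A) (f : F) : (inl a * inr f : Link A F) = inr (a • f) := by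
  ext <;> simp [inl, inr]

theorem inr_mul_inl (f : F) (a : A) : (inr f * inl a : Link A F) = inr (f <• a) := by
  ext <;> simp [inl, inr]

theorem prod_map_inl {ι : Type*} (l : List ι) (a : ι → A) :
    (l.map fun i => (inl (a i) : Link A F)).prod = inl (l.map a).prod := by
  induction l with
  | nil => rfl
  | cons x l ih => simp only [List.map_cons, List.prod_cons, ih, inl_mul_inl]

end Embeddings

theorem prodF_const {F : Type*} [NonUnitalRing F] {q : F} (hq : IsIdempotentElem q) (m : ℕ) :
    prodF (fun _ => q) m = q := by
  induction m with
  | zero => rfl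
  | succ m ih => rw [prodF, ih, hq.eq]

variable {A F : Type*} [Ring A] [Algebra ℂ A] [NonUnitalRing F] [Module ℂ F]
  [Module A F] [Module Aᵐᵒᵖ F] [BimoduleAlgebra A F]

theorem inr_altProd (q : F) (a : ℕ → A) (m : ℕ) :
    (inr (altProd a (fun _ => q) m) : Link A F) =
      ((List.range (m + 1)).map fun i => inl (a i) * inr q).prod * inl (a (m + 1)) := by
  induction m with
  | zero => simp [altProd, ← inl_mul_inr, ← inr_mul_inl, mul_assoc]
  | succ m ih =>
    rw [altProd, ← inr_mul_inr, ih, ← inr_mul_inl, List.range_succ (n := m + 1)]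
    simp [mul_assoc]

/-- The functional `φ'` evaluates the words `x q b₁ q ⋯ b_k q y`, with `x, b₁, …, b_k, y` in `A`, to
`φ(x y) φ(b₁) ⋯ φ(b_k)`. -/
def FactorsOnWords (φ : A →ₗ[ℂ] ℂ) (Φ : F →ₗ[ℂ] ℂ) (q : F) : Prop :=
  ∀ (x y : A) (l : List A),
    phi' Φ (((x :: l).map fun b => (inl b * inr q : Link A F)).prod * inl y) =
      φ (x * y) * (l.map φ).prod

theorem CyclicAntimonotone.factorsOnWords [IsScalarTower ℂ F F] [SMulCommClass ℂ F F]
    {φ : A →ₗ[ℂ] ℂ} {Φ : F →ₗ[ℂ] ℂ} {q : F} (hq : IsIdempotentElem q) (hΦq : Φ q = 1)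
    (hind : CyclicAntimonotone φ Φ ⊤ (NonUnitalAlgebra.adjoin ℂ {q})) :
    FactorsOnWords φ Φ q := by
  intro x y l
  have h := hind l.length (fun i => (x :: (l ++ [y])).getD i 0) (fun _ => q)
    (fun _ _ => Algebra.mem_top) (fun _ _ => NonUnitalAlgebra.self_mem_adjoin_singleton ℂ q)
  rw [prodF_const hq, hΦq, mul_one] at h
  have h1 : (l.map φ).prod =
      ∏ i ∈ Icc 1 l.length, φ ((x :: (l ++ [y])).getD i 0) := by
    rw [← Fin.prod_univ_fun_getElem, ← Finset.Ico_add_one_right_eq_Icc,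
      Finset.prod_Ico_eq_prod_range, Finset.prod_range]
    refine Finset.prod_congr (by simp) fun i _ => ?_
    simp [add_comm 1]
  have h2 : ((x :: l).map fun b => (inl b * inr q : Link A F)) =
      (List.range (l.length + 1)).map
        fun i => inl ((x :: (l ++ [y])).getD i 0) * inr q := by
    refine List.ext_getElem (by simp) fun i hi hi' => ?_
    simp only [List.length_map, List.length_cons] at hi
    have h3 : (x :: (l ++ [y])).getD i 0 = (x :: l)[i] := by
      rw [← List.cons_append, List.getD_eq_getElem _ _ (by simp; omega),
        List.getElem_append_left]
    simp only [List.getElem_map, List.getElem_range, h3]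
  have h4 : (x :: (l ++ [y])).getD (l.length + 1) 0 = y := by simp
  have h5 := inr_altProd q (fun i => (x :: (l ++ [y])).getD i 0) l.length
  rw [h1, h2]
  rw [h4] at h h5
  rw [← h5]
  exact h

namespace FactorsOnWords

variable {φ : A →ₗ[ℂ] ℂ} {Φ : F →ₗ[ℂ] ℂ} {q : F}

theorem phi'_inr_mul_inl (h : FactorsOnWords φ Φ q) (a : A) :
    phi' Φ (inr q * inl a : Link A F) = φ a := by
  have := h 1 a []
  simpa [show (inl 1 : Link A F) = 1 from rfl] using this

/-- Under `φ'`, a word `q b₁ q ⋯ b_k q a R`, where `R` is a product of factors `b (1 - q)`, only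
retains `q a R` and the scalars `φ(b₁), …, φ(b_k)`. The number of factors before `R` is arbitrary
because expanding the first factor of `R` moves a further `q` to the left of the rest of `R`. -/
theorem phi'_absorb (h : FactorsOnWords φ Φ q) (r l : List A) (a : A) :
    phi' Φ (((1 :: l).map fun b => (inl b * inr q : Link A F)).prod * inl a *
        (r.map fun b => (inl b * (1 - inr q) : Link A F)).prod) =
      (l.map φ).prod * phi' Φ (inr q * inl a *
        (r.map fun b => (inl b * (1 - inr q) : Link A F)).prod) := by
  induction r generalizing l a with
  | nil =>
    simp only [List.map_nil, List.prod_nil, mul_one]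
    rw [h, h.phi'_inr_mul_inl, one_mul, mul_comm]
  | cons b r ih =>
    set R := (r.map fun b => (inl b * (1 - inr q) : Link A F)).prod with hR
    have e : ∀ X : Link A F, X * inl a * (inl b * (1 - inr q) * R) =
        X * inl (a * b) * R - X * (inl (a * b) * inr q) * inl 1 * R := by
      intro X
      rw [← inl_mul_inl, show (inl 1 : Link A F) = 1 from rfl]
      noncomm_ring
    have e1 := ih (l ++ [a * b]) 1
    have e2 := ih [a * b] 1
    have e3 := ih l (a * b)
    simp only [List.map_cons, List.prod_cons, List.map_append, List.prod_append, List.map_nil,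
      List.prod_nil, mul_one, show (inl 1 : Link A F) = 1 from rfl, one_mul] at e e1 e2 e3 ⊢
    rw [e, e, map_sub, map_sub, e3, mul_sub, mul_assoc (inr q) _ (inl (a * b) * inr q), e1, e2]
    ring

/-- `φ'(q a b p c₁ p ⋯ c_k p) = 0` for `p = 1 - q`. Expanding the first `p` gives
`φ'(q ab R) - φ(ab) φ'(q R)` with `R = c₁ p ⋯ c_k p`; both terms vanish by induction, and for empty
`R` they cancel. -/
theorem phi'_inr_mul_inl_mul_prod (h : FactorsOnWords φ Φ q) (hφ : φ 1 = 1) (r : List A)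
    (a b : A) :
    phi' Φ (inr q * inl a *
      ((b :: r).map fun b => (inl b * (1 - inr q) : Link A F)).prod) = 0 := by
  have step : ∀ (r : List A) (a b : A), phi' Φ (inr q * inl a *
      ((b :: r).map fun b => (inl b * (1 - inr q) : Link A F)).prod) =
      phi' Φ (inr q * inl (a * b) * (r.map fun b => (inl b * (1 - inr q) : Link A F)).prod) -
        φ (a * b) * phi' Φ (inr q * inl 1 *
          (r.map fun b => (inl b * (1 - inr q) : Link A F)).prod) := by
    intro r a b
    have e := h.phi'_absorb r [a * b] 1
    simp only [List.map_cons, List.prod_cons, List.map_nil, List.prod_nil, mul_one,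
      show (inl 1 : Link A F) = 1 from rfl, one_mul] at e ⊢
    rw [← e, ← map_sub, ← inl_mul_inl]
    congr 1
    noncomm_ring
  induction r generalizing a b with
  | nil => rw [step]; simp [h.phi'_inr_mul_inl, hφ]
  | cons c r ih => rw [step, ih, ih, mul_zero, sub_zero]

/-- In the product of the `p b p`, with `p = 1 - q`, the leftmost `p` is invisible to `φ'`. -/
theorem phi'_prod_compression (h : FactorsOnWords φ Φ q) (hφ : φ 1 = 1)
    (hq : IsIdempotentElem q) (a : A) (r : List A) :
    phi' Φ ((a :: r).map fun b => ((1 - inr q) * inl b * (1 - inr q) : Link A F)).prod =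
      phi' Φ ((a :: r).map fun b => (inl b * (1 - inr q) : Link A F)).prod := by
  have hp : ((1 - inr q) * (1 - inr q) : Link A F) = 1 - inr q :=
    IsIdempotentElem.one_sub (show inr q * inr q = inr q by rw [inr_mul_inr, hq.eq])
  have hprod : ∀ r : List A, (1 - inr q : Link A F) *
      (r.map fun b => ((1 - inr q) * inl b * (1 - inr q) : Link A F)).prod =
      (1 - inr q) * (r.map fun b => (inl b * (1 - inr q) : Link A F)).prod := by
    intro r
    induction r with
    | nil => rfl
    | cons b r ih =>
      have e : ∀ X : Link A F, (1 - inr q) * ((1 - inr q) * inl b * (1 - inr q) * X) =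
          (1 - inr q) * (1 - inr q) * inl b * ((1 - inr q) * X) := fun X => by
        simp only [mul_assoc]
      rw [List.map_cons, List.map_cons, List.prod_cons, List.prod_cons, e, hp, ih]
      simp only [mul_assoc]
  have h0 := h.phi'_inr_mul_inl_mul_prod hφ r 1 a
  rw [show (inl 1 : Link A F) = 1 from rfl, mul_one] at h0
  have h1 := hprod (a :: r)
  have h2 : (1 - inr q : Link A F) *
      ((a :: r).map fun b => ((1 - inr q) * inl b * (1 - inr q) : Link A F)).prod =
      ((a :: r).map fun b => ((1 - inr q) * inl b * (1 - inr q) : Link A F)).prod := by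
    simp only [List.map_cons, List.prod_cons, ← mul_assoc, hp]
  rw [← h2, h1, sub_mul, one_mul, map_sub, h0, sub_zero]

/-- The word in which `q` follows exactly the factors with index in `C` is evaluated to the moment
of the cyclic interval partition of `C`: each `q` other than the first one closes the block of its
index, and the segments before the first and after the last `q` form the block of the least cut. -/
theorem phi'_prod_cut [IsScalarTower ℂ F F] [SMulCommClass ℂ F F] (h : FactorsOnWords φ Φ q)
    {n : ℕ} (a : Fin n → A) {C : Finset (Fin n)} (hC : C.Nonempty) :
    phi' Φ (List.ofFn (C.piecewise (fun i => inl (a i) * inr q)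
      (fun i => (inl (a i) : Link A F)))).prod =
      moment (phi (F := F) φ) (cyclicInterval C) fun i => inl (a i) := by
  classical
  set D : Finset ℕ := C.map Fin.valEmbedding with hD
  have memD : ∀ x, x ∈ D ↔ ∃ hx : x < n, (⟨x, hx⟩ : Fin n) ∈ C := by
    intro x
    simp only [hD, mem_map, Fin.valEmbedding_apply]
    constructor
    · rintro ⟨y, hy, rfl⟩
      exact ⟨y.2, hy⟩
    · rintro ⟨hx, hC⟩
      exact ⟨_, hC, rfl⟩
  -- indices are moved to `ℕ`; the value `1` outside `Fin n` is never used
  set a' : ℕ → A := fun i => if hi : i < n then a ⟨i, hi⟩ else 1 with ha'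
  have ha'' : ∀ i : Fin n, a' i = a i := fun i => by simp [ha']
  have hblock : ∀ (c : Fin n) (l : List ℕ), l.Pairwise (· < ·) →
      (∀ x, x ∈ l ↔ ∃ hx : x < n, cutSetoid C c ⟨x, hx⟩) →
      phi (F := F) φ (((({x | cutSetoid C c x} : Finset (Fin n)).sort (· ≤ ·)).map
        fun i => (inl (a i) : Link A F)).prod) = φ (l.map a').prod := by
    intro c l hl hmem
    rw [← sort_map_val_eq ({x | cutSetoid C c x} : Finset (Fin n)) l hl (by simpa using hmem),
      List.map_map, prod_map_inl]
    simp [phi, inl, Function.comp_def, ha'']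
  obtain ⟨c₀, cs, hcs⟩ : ∃ c₀ cs, C.sort (· ≤ ·) = c₀ :: cs := by
    refine List.exists_cons_of_ne_nil fun h0 => hC.ne_empty ?_
    rw [← Finset.sort_toFinset C (· ≤ ·), h0, List.toFinset_nil]
  have hsorted : (c₀ :: cs).Pairwise (· < ·) := hcs ▸ C.sortedLT_sort.pairwise
  have hmemC : ∀ d, d ∈ C ↔ d = c₀ ∨ d ∈ cs := fun d => by
    rw [← Finset.mem_sort (· ≤ ·), hcs, List.mem_cons]
  have hlt : ∀ d ∈ cs, c₀ < d := (List.pairwise_cons.1 hsorted).1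
  have hmin : ∀ d ∈ C, c₀ ≤ d := fun d hd =>
    ((hmemC d).1 hd).elim (fun h => h.ge) fun h => (hlt d h).le
  have hc₀ : c₀ ∈ C := (hmemC c₀).2 (Or.inl rfl)
  have hfilter : (List.range n).filter (· ∈ D) = (c₀ :: cs).map Fin.val := by
    rw [← hcs]
    refine (sort_map_val_eq C _ (List.pairwise_lt_range.filter _) fun x => ?_).symm
    simp only [List.mem_filter, List.mem_range, decide_eq_true_eq, memD]
    exact ⟨fun h => h.2, fun h => ⟨h.1, h⟩⟩
  have hword : List.ofFn (C.piecewise (fun i => inl (a i) * inr q)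
      (fun i => (inl (a i) : Link A F))) =
      (List.range n).map fun i => if i ∈ D then inl (a' i) * inr q else inl (a' i) := by
    refine List.ext_getElem (by simp) fun i hi hi' => ?_
    have hin : i < n := by simpa using hi
    simp only [List.getElem_ofFn, List.getElem_map, List.getElem_range, Finset.piecewise]
    have h1 : i ∈ D ↔ (⟨i, hin⟩ : Fin n) ∈ C := by simp [memD, hin]
    simp [h1, ha', hin]
  rw [hword, prod_range_cut, hfilter, moment, prod_parts_cyclicInterval hC, ← prod_map_sort, hcs]
  simp only [prod_map_inl, List.map_map]
  have hW := h ((tailSegment D c₀ ++ [c₀.val]).map a').prod ((tailSegment D n).map a').prod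
    (cs.map fun c => ((tailSegment D c ++ [c.val]).map a').prod)
  rw [List.map_cons, List.map_map, List.map_map] at hW
  rw [List.map_cons, List.map_cons, List.prod_cons (l := List.map _ cs)]
  refine hW.trans ?_
  congr 1
  · -- the block of the least cut
    rw [← List.prod_append, ← List.map_append, ← hblock c₀, prod_map_inl]
    · rw [List.pairwise_append, List.pairwise_append]
      refine ⟨⟨pairwise_tailSegment _ _, by simp, ?_⟩, pairwise_tailSegment _ _, ?_⟩
      · intro x hx y hy
        rw [List.mem_singleton.1 hy]
        exact ((mem_tailSegment _ _ _).1 hx).1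
      · intro x hx y hy
        have h1 := ((mem_tailSegment _ _ _).1 hy).2 c₀ ((memD _).2 ⟨c₀.2, hc₀⟩) c₀.2
        rcases List.mem_append.1 hx with hx | hx
        · exact ((mem_tailSegment _ _ _).1 hx).1.trans h1
        · rwa [List.mem_singleton.1 hx]
    · intro x
      simp only [cutSetoid_min_iff hc₀ hmin, List.mem_append, mem_tailSegment,
        List.mem_singleton, memD]
      constructor
      · rintro ((⟨h1, -⟩ | rfl) | ⟨h1, h2⟩)
        · exact ⟨h1.trans c₀.2, Or.inl (Fin.le_def.2 h1.le)⟩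
        · exact ⟨c₀.2, Or.inl le_rfl⟩
        · exact ⟨h1, Or.inr fun d hd => h2 d ⟨d.2, hd⟩ d.2⟩
      · rintro ⟨hx, h1 | h1⟩
        · rcases (Fin.le_def.1 h1).lt_or_eq with h2 | h2
          · refine Or.inl (Or.inl ⟨h2, ?_⟩)
            rintro d ⟨hd, hdC⟩ hdc
            exact absurd hdc (Fin.le_def.1 (hmin _ hdC)).not_gt
          · exact Or.inl (Or.inr h2)
        · exact Or.inr ⟨hx, fun d ⟨hd, hdC⟩ _ => h1 ⟨d, hd⟩ hdC⟩
  · congr 1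
    refine List.map_congr_left fun c hc => ?_
    rw [Function.comp, ← hblock c, prod_map_inl]
    · rw [List.pairwise_append]
      refine ⟨pairwise_tailSegment _ _, by simp, fun x hx y hy => ?_⟩
      rw [List.mem_singleton.1 hy]
      exact ((mem_tailSegment _ _ _).1 hx).1
    · intro x
      simp only [cutSetoid_not_min_iff ((hmemC c).2 (Or.inr hc)) hc₀ (hlt c hc),
        List.mem_append, mem_tailSegment, List.mem_singleton, memD]
      constructor
      · rintro (⟨h1, h2⟩ | rfl)
        · exact ⟨h1.trans c.2, Fin.le_def.2 h1.le, fun d hd hdc => h2 d ⟨d.2, hd⟩ hdc⟩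
        · exact ⟨c.2, le_rfl, fun d _ hdc => hdc⟩
      · rintro ⟨hx, h1, h2⟩
        rcases (Fin.le_def.1 h1).lt_or_eq with h3 | h3
        · exact Or.inl ⟨h3, fun d ⟨hd, hdC⟩ hdc => h2 ⟨d, hd⟩ hdC hdc⟩
        · exact Or.inr h3

/-- Expansion of `φ'(p a₁ p ⋯ aₙ p)`. The hypothesis `1 ≤ n` excludes the empty product, which is
`1` rather than `p`. -/
theorem phi'_prod_compression_eq_sum [IsScalarTower ℂ F F] [SMulCommClass ℂ F F]
    (h : FactorsOnWords φ Φ q) (hφ : φ 1 = 1) (hq : IsIdempotentElem q) {n : ℕ} (hn : 1 ≤ n)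
    (a : Fin n → A) :
    phi' Φ (List.ofFn fun i : Fin n =>
        ((1 - inr q) * inl (a i) * (1 - inr q) : Link A F)).prod =
      ∑ C : Finset (Fin n) with C.Nonempty,
        (-1) ^ C.card * moment (phi (F := F) φ) (cyclicInterval C) fun i => inl (a i) := by
  classical
  have h1 : phi' Φ (List.ofFn fun i : Fin n =>
        ((1 - inr q) * inl (a i) * (1 - inr q) : Link A F)).prod =
      phi' Φ (List.ofFn fun i : Fin n => (inl (a i) * (1 - inr q) : Link A F)).prod := by
    obtain ⟨m, rfl⟩ : ∃ m, n = m + 1 := ⟨n - 1, by omega⟩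
    have := h.phi'_prod_compression hφ hq (a 0) (List.ofFn fun i : Fin m => a i.succ)
    rw [← List.ofFn_succ, List.map_ofFn, List.map_ofFn] at this
    exact this
  have h2 : ∀ C : Finset (Fin n),
      (List.ofFn (C.piecewise (fun i => -(inl (a i) * inr q))
        (fun i => (inl (a i) : Link A F)))).prod =
      (-1 : ℂ) ^ C.card • (List.ofFn (C.piecewise (fun i => inl (a i) * inr q)
        (fun i => (inl (a i) : Link A F)))).prod := by
    intro C
    have := (MultilinearMap.mkPiAlgebraFin ℂ n (Link A F)).map_piecewise_smul (fun _ => -1)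
      (C.piecewise (fun i => inl (a i) * inr q) (fun i => (inl (a i) : Link A F))) C
    rw [Finset.prod_const, MultilinearMap.mkPiAlgebraFin_apply,
      MultilinearMap.mkPiAlgebraFin_apply] at this
    rw [← this]
    congr 2
    funext i
    by_cases hi : i ∈ C <;> simp [hi]
  have h3 : (List.ofFn fun i : Fin n => (inl (a i) * (1 - inr q) : Link A F)).prod =
      ∑ C : Finset (Fin n), (-1 : ℂ) ^ C.card •
        (List.ofFn (C.piecewise (fun i => inl (a i) * inr q)
          (fun i => (inl (a i) : Link A F)))).prod := by
    have := (MultilinearMap.mkPiAlgebraFin ℂ n (Link A F)).map_add_univ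
      (fun i => -(inl (a i) * inr q)) (fun i => inl (a i))
    simp only [MultilinearMap.mkPiAlgebraFin_apply, h2] at this
    rw [← this]
    congr 2
    funext i
    simp only [Pi.add_apply]
    noncomm_ring
  rw [h1, h3, map_sum, ← Finset.sum_filter_add_sum_filter_not univ
    fun C : Finset (Fin n) => C.Nonempty]
  have h4 : univ.filter (fun C : Finset (Fin n) => ¬ C.Nonempty) = {∅} := by
    ext C
    simp [Finset.not_nonempty_iff_eq_empty]
  -- the word without any `q` lies in `A`, where `φ'` vanishes
  have h5 : phi' Φ (List.ofFn fun i : Fin n => (inl (a i) : Link A F)).prod = 0 := by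
    rw [List.ofFn_eq_map, prod_map_inl]
    simp [phi', inl]
  rw [h4, sum_singleton, piecewise_empty, map_smul, h5, smul_zero, add_zero]
  refine sum_congr (by congr) fun C hC => ?_
  rw [map_smul, smul_eq_mul, h.phi'_prod_cut a (mem_filter.1 hC).2]

end FactorsOnWords

end LinkAlgebra

end TypeBPrime

theorem theorem5p1 {A F : Type*} [Ring A] [Algebra ℂ A]
    [NonUnitalRing F] [Module ℂ F] [IsScalarTower ℂ F F] [SMulCommClass ℂ F F]
    [Module A F] [Module Aᵐᵒᵖ F] [TypeBPrime.BimoduleAlgebra A F]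
    (φ : A →ₗ[ℂ] ℂ) (hφ : φ 1 = 1) (Φ : F →ₗ[ℂ] ℂ)
    (q : F) (hq : IsIdempotentElem q) (hΦq : Φ q = 1)
    (hind : TypeBPrime.CyclicAntimonotone φ Φ ⊤ (NonUnitalAlgebra.adjoin ℂ {q}))
    (n : ℕ) (hn : 1 ≤ n) (a : Fin n → A) :
    TypeBPrime.Link.phi' Φ (List.ofFn fun i : Fin n =>
        (1 - TypeBPrime.Link.inr q : TypeBPrime.Link A F) * TypeBPrime.Link.inl (a i) *
          (1 - TypeBPrime.Link.inr q)).prod =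
      -∑ π : TypeBPrime.NC n, ((TypeBPrime.kreweras π).1.parts.card : ℂ) *
        TypeBPrime.freeCumulant (TypeBPrime.Link.phi (F := F) φ) π
          (fun i => TypeBPrime.Link.inl (a i)) := by
  have h := hind.factorsOnWords hq hΦq
  rw [h.phi'_prod_compression_eq_sum hφ hq hn a,
    TypeBPrime.sum_card_kreweras_mul_freeCumulant, ← Finset.sum_neg_distrib]
  refine Finset.sum_congr (by congr) fun C _ => ?_
  ring
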